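/- Let $M=\mathbb R^4$ be Minkowski space with the indefinite product $pa=p_0a_0-p_1a_1-p_2a_2-p_3a_3$. Let $\mathcal A$ be a $C^*$-algebra on which the translation group $M$ acts by $*$-automorphisms $\alpha_a$ (for example the quasilocal algebra of a theory of local observables). Let $\{\pi,\mathcal H,U\}$ be a covariant representation: $\pi$ is a non-degenerate $*$-representation of $\mathcal A$ on a Hilbert space $\mathcal H$ and $U$ is a strongly continuous unitary representation of $M$ on $\mathcal H$ with $U(a)\pi(x)U(a)^*=\pi(\alpha_a x)$ for all $x\in\mathcal A$, $a\in M$. Let $E$ be the spectral measure of $U$, i.e. the projection-valued measure on the Borel sets of $M$ with $U(a)=\int_M e^{ipa}\,dE(p)$; put $\operatorname{spec}U:=\operatorname{supp}dE$, and for $\Psi\in\mathcal H$ let $\operatorname{supp}\Psi$ be the smallest closed set $S\subset\operatorname{spec}U$ with $E(S)\Psi=\Psi$. For a tempered distribution $T\in\mathcal S'(M)$ let $\widetilde T(\rho)=T(\widetilde\rho)$ with $\widetilde\rho(a)=(2\pi)^{-2}\int_M e^{-ipa}\rho(p)\,dp$, $\rho\in\mathcal S(M)$. Sums and differences of sets are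 Minkowski sums and differences, and $2\operatorname{supp}\Psi:=\operatorname{supp}\Psi+\operatorname{supp}\Psi$. For all $x\in\mathcal A$ and $\Psi\in\mathcal H$ the functions $$F^+_{x,\Psi}(a)=(\Psi,\pi(x^*)U(a)\pi(x)\Psi),\qquad F^-_{x,\Psi}(a)=(\Psi,\pi(\alpha_a x)\pi(x^*)U(a)\Psi)$$ on $M$ are continuous and bounded, and hence define tempered distributions $\rho\mapsto\int_M F^\pm_{x,\Psi}(a)\rho(a)\,da$ in $\mathcal S'(M)$. Their Fourier transforms satisfy: 1. $\operatorname{supp}\widetilde{F^+_{x,\Psi}}\subset\operatorname{spec}U$. 2. $\widetilde{F^-_{x,\Psi}}(\rho)=0$ for every $\rho\in\mathcal S(M)$ with $\operatorname{supp}\rho\cap(2\operatorname{supp}\Psi-\operatorname{spec}U)=\emptyset$. Consequently $\operatorname{supp}\widetilde{F^-_{x,\Psi}}\subset\overline{2\operatorname{supp}\Psi-\operatorname{spec}U}$, and $\operatorname{supp}\widetilde{F^-_{x,\Psi}}\subset 2\operatorname{supp}\Psi-\operatorname{spec}U$ if $\operatorname{supp}\Psi$ is compact. -/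

import Mathlib

open MeasureTheory Distribution
open scoped SchwartzMap FourierTransform InnerProductSpace Pointwise

noncomputable section

namespace LocalQFT

/-! ### Minkowski space and its Fourier transform -/

/-- The vector space underlying (1+3)-dimensional Minkowski space, coordinates `0, 1, 2, 3`. The
Euclidean structure only serves as topology, Lebesgue measure and Schwartz space. -/
abbrev Minkowski : Type := EuclideanSpace ℝ (Fin 4)

/-- The indefinite scalar product `p a = p₀ a₀ - p₁ a₁ - p₂ a₂ - p₃ a₃`. -/
def mdot (p a : Minkowski) : ℝ := p 0 * a 0 - ∑ i : Fin 3, p i.succ * a i.succ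

/-- The linear isomorphism `a ↦ (2π)⁻¹ (a₀, -a₁, -a₂, -a₃)`, which turns Mathlib's kernel
`exp (-2πi ⟨p, ·⟩)` into the kernel `exp (-i p a)`. -/
def rescale : Minkowski ≃L[ℝ] Minkowski :=
  LinearEquiv.toContinuousLinearEquiv
    { toFun := fun a => WithLp.toLp 2 fun i => (2 * Real.pi)⁻¹ * ((if i = 0 then 1 else -1) * a i)
      invFun := fun a => WithLp.toLp 2 fun i => 2 * Real.pi * ((if i = 0 then 1 else -1) * a i)
      map_add' := fun a b => by ext i; simp [mul_add]
      map_smul' := fun c a => by ext i; simp [mul_left_comm]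
      left_inv := fun a => by
        ext i
        have := Real.pi_ne_zero
        by_cases h : i = 0 <;> simp [h] <;> field_simp
      right_inv := fun a => by
        ext i
        have := Real.pi_ne_zero
        by_cases h : i = 0 <;> simp [h] <;> field_simp }

theorem inner_rescale (p a : Minkowski) :
    2 * Real.pi * inner ℝ p (rescale a) = mdot p a := by
  have := Real.pi_ne_zero
  simp [rescale, mdot, PiLp.inner_apply, Fin.sum_univ_succ]
  field_simp
  ring

/-- The Fourier transform on Schwartz functions of Minkowski space,
`ρ̃(a) = (2π)⁻² ∫ exp (-i p a) ρ(p) dp`, see `fourierTest_apply`. -/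
def fourierTest : 𝓢(Minkowski, ℂ) →L[ℂ] 𝓢(Minkowski, ℂ) :=
  ((2 * Real.pi : ℂ) ^ 2)⁻¹ •
    (SchwartzMap.compCLMOfContinuousLinearEquiv ℂ rescale ∘L
      FourierTransform.fourierCLM ℂ 𝓢(Minkowski, ℂ))

theorem fourierTest_apply (ρ : 𝓢(Minkowski, ℂ)) (a : Minkowski) :
    fourierTest ρ a =
      ((2 * Real.pi : ℂ) ^ 2)⁻¹ * ∫ p, Complex.exp (-Complex.I * (mdot p a : ℂ)) * ρ p := by
  have h : fourierTest ρ a = ((2 * Real.pi : ℂ) ^ 2)⁻¹ * (𝓕 (ρ : Minkowski → ℂ)) (rescale a) := rfl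
  rw [h, Real.fourier_eq']
  congr 2
  ext p
  rw [← inner_rescale, smul_eq_mul]
  congr 2
  push_cast
  ring

/-- The Fourier transform of tempered distributions, `T̃(ρ) = T(ρ̃)`. -/
def fourierDist (T : 𝓢'(Minkowski, ℂ)) : 𝓢'(Minkowski, ℂ) :=
  PointwiseConvergenceCLM.precomp ℂ fourierTest T

/-- `T` is the tempered distribution given by the function `F`, i.e. `T(ρ) = ∫ F(a) ρ(a) da`. -/
def IsGivenBy (T : 𝓢'(Minkowski, ℂ)) (F : Minkowski → ℂ) : Prop :=
  ∀ ρ : 𝓢(Minkowski, ℂ), Integrable (fun a => F a * ρ a) ∧ T ρ = ∫ a, F a * ρ a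

/-! ### Projection-valued measures -/

/-- A (normalised, σ-additive) projection-valued measure on the Borel sets of Minkowski space. The
values of `proj` on sets that are not Borel are irrelevant. -/
structure ProjectionValuedMeasure (H : Type*) [NormedAddCommGroup H] [InnerProductSpace ℂ H]
    [CompleteSpace H] where
  proj : Set Minkowski → H →L[ℂ] H
  isStarProjection : ∀ S, MeasurableSet S → IsStarProjection (proj S)
  proj_univ : proj Set.univ = 1
  hasSum : ∀ S : ℕ → Set Minkowski, (∀ i, MeasurableSet (S i)) →
    Pairwise (Function.onFun Disjoint S) →
    ∀ Φ : H, HasSum (fun i => proj (S i) Φ) (proj (⋃ i, S i) Φ)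

section

variable {H : Type*} [NormedAddCommGroup H] [InnerProductSpace ℂ H] [CompleteSpace H]

namespace ProjectionValuedMeasure

theorem inner_proj (E : ProjectionValuedMeasure H) {S : Set Minkowski} (hS : MeasurableSet S)
    (Φ : H) : (⟪Φ, E.proj S Φ⟫_ℂ).re = ‖E.proj S Φ‖ ^ 2 := by
  have h := E.isStarProjection S hS
  have h1 : E.proj S (E.proj S Φ) = E.proj S Φ := congrArg (fun A : H →L[ℂ] H => A Φ) h.1
  have h2 : ContinuousLinearMap.adjoint (E.proj S) = E.proj S := h.2
  have h3 : ⟪Φ, E.proj S Φ⟫_ℂ = ⟪E.proj S Φ, E.proj S Φ⟫_ℂ := by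
    conv_lhs => rw [← h1]
    rw [← ContinuousLinearMap.adjoint_inner_left, h2]
  rw [h3, inner_self_eq_norm_sq_to_K]
  norm_cast

theorem proj_empty (E : ProjectionValuedMeasure H) (Φ : H) : E.proj ∅ Φ = 0 := by
  have h := E.hasSum (fun _ => ∅) (fun _ => MeasurableSet.empty) (fun _ _ _ => by simp) Φ
  have h' : Filter.Tendsto (fun _ : ℕ => E.proj ∅ Φ) Filter.atTop (nhds 0) :=
    h.summable.tendsto_atTop_zero
  exact tendsto_nhds_unique tendsto_const_nhds h'

/-- The scalar measure `(Φ, dE(p) Φ)`. -/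
def diag (E : ProjectionValuedMeasure H) (Φ : H) : Measure Minkowski :=
  Measure.ofMeasurable (fun S _ => ENNReal.ofReal (⟪Φ, E.proj S Φ⟫_ℂ).re)
    (by simp [proj_empty])
    (fun S hS hd => by
      have h : HasSum (fun i => (⟪Φ, E.proj (S i) Φ⟫_ℂ).re) (⟪Φ, E.proj (⋃ i, S i) Φ⟫_ℂ).re :=
        Complex.hasSum_re ((E.hasSum S hS hd Φ).mapL (innerSL ℂ Φ))
      rw [← h.tsum_eq, ENNReal.ofReal_tsum_of_nonneg _ h.summable]
      intro i
      rw [E.inner_proj (hS i)]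
      positivity)

/-- The support of `dE`: the points all of whose open neighbourhoods have a nonzero projection. -/
def support (E : ProjectionValuedMeasure H) : Set Minkowski :=
  {p | ∀ V : Set Minkowski, IsOpen V → p ∈ V → E.proj V ≠ 0}

/-- The smallest closed set `S ⊆ supp dE` with `E(S) Ψ = Ψ`. -/
def vectorSupport (E : ProjectionValuedMeasure H) (Ψ : H) : Set Minkowski :=
  ⋂₀ {S | IsClosed S ∧ S ⊆ E.support ∧ E.proj S Ψ = Ψ}

end ProjectionValuedMeasure

/-- `E` is the spectral measure of the unitary representation `U`, i.e.
`U(a) = ∫ exp (i p a) dE(p)` (as quadratic forms). -/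
def IsSpectralMeasure (E : ProjectionValuedMeasure H)
    (U : Multiplicative Minkowski →* unitary (H →L[ℂ] H)) : Prop :=
  ∀ (a : Minkowski) (Φ : H),
    ⟪Φ, (U (.ofAdd a) : H →L[ℂ] H) Φ⟫_ℂ =
      ∫ p, Complex.exp (Complex.I * (mdot p a : ℂ)) ∂(E.diag Φ)

/-- `spec U = supp dE`, where `E` is the spectral measure of the (strongly continuous) `U`; a
spectral measure exists and is unique on the Borel sets. -/
def spec (U : Multiplicative Minkowski →* unitary (H →L[ℂ] H)) : Set Minkowski :=
  {p | ∀ E : ProjectionValuedMeasure H, IsSpectralMeasure E U → p ∈ E.support}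

/-- `supp Ψ`: the smallest closed set `S ⊆ spec U` with `E(S) Ψ = Ψ`, where `E` is the spectral
measure of `U`. -/
def vecSupp (U : Multiplicative Minkowski →* unitary (H →L[ℂ] H)) (Ψ : H) : Set Minkowski :=
  {p | ∀ E : ProjectionValuedMeasure H, IsSpectralMeasure E U → p ∈ E.vectorSupport Ψ}

end

/-! ### Covariant representations -/

/-- A covariant representation `{π, H, U}` of a C⋆-algebra `A` on which the translation group acts
by the automorphisms `α a`. -/
structure CovariantRepresentation {A : Type*} [NonUnitalCStarAlgebra A]
    (α : Multiplicative Minkowski →* (A ≃⋆ₐ[ℂ] A))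
    (H : Type*) [NormedAddCommGroup H] [InnerProductSpace ℂ H] [CompleteSpace H] where
  π : A →⋆ₙₐ[ℂ] (H →L[ℂ] H)
  U : Multiplicative Minkowski →* unitary (H →L[ℂ] H)
  nondegenerate : (Submodule.span ℂ {v : H | ∃ x Φ, v = π x Φ}).topologicalClosure = ⊤
  continuous : ∀ Φ : H, Continuous fun a : Minkowski => (U (.ofAdd a) : H →L[ℂ] H) Φ
  covariant : ∀ (x : A) (a : Minkowski),
    (U (.ofAdd a) : H →L[ℂ] H) * π x * star (U (.ofAdd a) : H →L[ℂ] H) = π (α (.ofAdd a) x)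

namespace CovariantRepresentation

variable {A : Type*} [NonUnitalCStarAlgebra A] {α : Multiplicative Minkowski →* (A ≃⋆ₐ[ℂ] A)}
  {H : Type*} [NormedAddCommGroup H] [InnerProductSpace ℂ H] [CompleteSpace H]

/-- `F⁺(a) = (Ψ, π(x⋆) U(a) π(x) Ψ)`. -/
def Fplus (R : CovariantRepresentation α H) (x : A) (Ψ : H) (a : Minkowski) : ℂ :=
  ⟪Ψ, R.π (star x) ((R.U (.ofAdd a) : H →L[ℂ] H) (R.π x Ψ))⟫_ℂ

/-- `F⁻(a) = (Ψ, π(α_a x) π(x⋆) U(a) Ψ)`. -/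
def Fminus (R : CovariantRepresentation α H) (x : A) (Ψ : H) (a : Minkowski) : ℂ :=
  ⟪Ψ, R.π (α (.ofAdd a) x) (R.π (star x) ((R.U (.ofAdd a) : H →L[ℂ] H) Ψ))⟫_ℂ

end CovariantRepresentation

end LocalQFT

end

/-! Inserting `U(a) = ∫ exp(ipa) dE(p)` shows what to expect. The function `F⁺(a) = (π(x)Ψ,
U(a)π(x)Ψ)` is the Fourier transform of the finite measure `E.diag (π(x)Ψ)`, which lives on `spec
U`. By covariance, `F⁻(a) = (Ψ, U(a) X U(-a) Y U(a) Ψ)` with `X = π(x)` and `Y = π(x⋆)`. Its three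
unitaries contribute frequencies `p`, `-q`, `r` with `p, r ∈ supp Ψ` and `q ∈ spec U`.

The expression `dE(p) X dE(q) Y dE(r)` need not be a measure, so the second claim is proved by
smearing. If `Φ` has its spectral support in a compact `K`, and the transform of `g` is `1` on `K`
and `0` off a neighbourhood `O`, then `Φ = ∫ g(c) U(c)Φ dc` (`integral_smul_act_eq`). Hence `U(a)Φ =
∫ g(c - a) U(c)Φ dc`, where `a` enters only through a scalar. A unitary can thus be traded for plane
waves with momenta in `O` (`integral_mul_inner_act_eq_zero`). Doing this three times leaves `∫ ρ̃(a)
exp(i(p + r - q)a) da`, a multiple of `ρ(p + r - q)`, which is zero. Cutting `Ψ` and the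
intermediate vector off to balls provides the compact supports, and dominated convergence removes
the cutoffs. -/

noncomputable section

namespace LocalQFT

/-! ### Projection-valued measures: null sets, supports, uniqueness -/

section

variable {H : Type*} [NormedAddCommGroup H] [InnerProductSpace ℂ H] [CompleteSpace H]

namespace ProjectionValuedMeasure

theorem diag_apply (E : ProjectionValuedMeasure H) (Φ : H) {S : Set Minkowski}
    (hS : MeasurableSet S) : E.diag Φ S = ENNReal.ofReal (‖E.proj S Φ‖ ^ 2) := by
  rw [diag, Measure.ofMeasurable_apply S hS, E.inner_proj hS]

instance (E : ProjectionValuedMeasure H) (Φ : H) : IsFiniteMeasure (E.diag Φ) :=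
  ⟨by rw [E.diag_apply Φ MeasurableSet.univ]; exact ENNReal.ofReal_lt_top⟩

theorem diag_eq_zero_iff (E : ProjectionValuedMeasure H) (Φ : H) {S : Set Minkowski}
    (hS : MeasurableSet S) : E.diag Φ S = 0 ↔ E.proj S Φ = 0 := by
  rw [E.diag_apply Φ hS, ENNReal.ofReal_eq_zero]
  constructor
  · intro h
    have : ‖E.proj S Φ‖ ^ 2 = 0 := le_antisymm h (sq_nonneg _)
    simpa using this
  · intro h
    simp [h]

theorem proj_compl (E : ProjectionValuedMeasure H) (Φ : H) {S : Set Minkowski}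
    (hS : MeasurableSet S) : E.proj Sᶜ Φ = Φ - E.proj S Φ := by
  -- Additivity is postulated for sequences only, so the pair `S`, `Sᶜ` is padded with empty sets.
  let T : ℕ → Set Minkowski := fun n => if n = 0 then S else if n = 1 then Sᶜ else ∅
  have hT : ∀ i, MeasurableSet (T i) := by
    intro i
    simp only [T]
    split_ifs
    exacts [hS, hS.compl, MeasurableSet.empty]
  have hd : Pairwise (Function.onFun Disjoint T) := by
    intro i j hij
    simp only [T, Function.onFun]
    split_ifs <;> first | omega | simp [disjoint_compl_right, disjoint_compl_left]
  have hU : ⋃ i, T i = Set.univ := by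
    refine Set.eq_univ_of_forall fun p => ?_
    by_cases hp : p ∈ S
    · exact Set.mem_iUnion.2 ⟨0, by simpa [T] using hp⟩
    · exact Set.mem_iUnion.2 ⟨1, by simpa [T] using hp⟩
  have h := E.hasSum T hT hd Φ
  have h' : HasSum (fun i => E.proj (T i) Φ) (∑ i ∈ Finset.range 2, E.proj (T i) Φ) := by
    refine hasSum_sum_of_ne_finset_zero fun i hi => ?_
    have : T i = ∅ := by
      simp only [Finset.mem_range, not_lt] at hi
      simp only [T]
      rw [if_neg (by omega), if_neg (by omega)]
    rw [this, E.proj_empty]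
  have := h.unique h'
  rw [hU, E.proj_univ] at this
  simp only [T, Finset.sum_range_succ, Finset.sum_range_zero] at this
  simp only [one_ne_zero, if_true, if_false, zero_add, one_apply_eq_self] at this
  rw [eq_sub_iff_add_eq, add_comm]
  exact this.symm

theorem proj_eq_self_iff (E : ProjectionValuedMeasure H) (Φ : H) {S : Set Minkowski}
    (hS : MeasurableSet S) : E.proj S Φ = Φ ↔ E.diag Φ Sᶜ = 0 := by
  rw [E.diag_eq_zero_iff Φ hS.compl, E.proj_compl Φ hS, sub_eq_zero, eq_comm]

theorem proj_proj (E : ProjectionValuedMeasure H) (Φ : H) {S : Set Minkowski}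
    (hS : MeasurableSet S) : E.proj S (E.proj S Φ) = E.proj S Φ :=
  congrArg (fun A : H →L[ℂ] H => A Φ) (E.isStarProjection S hS).1

theorem norm_proj_apply_le (E : ProjectionValuedMeasure H) (Φ : H) {S : Set Minkowski}
    (hS : MeasurableSet S) : ‖E.proj S Φ‖ ≤ ‖Φ‖ := by
  have h1 : ‖E.proj S Φ‖ ^ 2 ≤ ‖Φ‖ * ‖E.proj S Φ‖ := by
    rw [← E.inner_proj hS]
    exact (Complex.re_le_norm _).trans (norm_inner_le_norm _ _)
  by_contra! h
  nlinarith [norm_nonneg Φ]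

theorem isClosed_support (E : ProjectionValuedMeasure H) : IsClosed E.support := by
  refine ⟨isOpen_iff_forall_mem_open.2 fun p hp => ?_⟩
  simp only [support, Set.mem_compl_iff, Set.mem_ofPred_eq, not_forall, not_not] at hp
  obtain ⟨V, hV, hpV, h0⟩ := hp
  exact ⟨V, fun q hq hq' => hq' V hV hq h0, hV, hpV⟩

/-- The complement is a union of open null sets, possibly uncountable; the Lindelöf property makes
it null. -/
theorem diag_compl_support (E : ProjectionValuedMeasure H) (Φ : H) : E.diag Φ E.supportᶜ = 0 := by
  refine measure_null_of_locally_null _ fun p hp => ?_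
  simp only [support, Set.mem_compl_iff, Set.mem_ofPred_eq, not_forall, not_not] at hp
  obtain ⟨V, hV, hpV, h0⟩ := hp
  refine ⟨V, mem_nhdsWithin_of_mem_nhds (hV.mem_nhds hpV), ?_⟩
  rw [E.diag_eq_zero_iff Φ hV.measurableSet, h0, zero_apply]

theorem isClosed_vectorSupport (E : ProjectionValuedMeasure H) (Ψ : H) :
    IsClosed (E.vectorSupport Ψ) :=
  isClosed_sInter fun _ hS => hS.1

/-- The Lindelöf property again handles an uncountable intersection: the intersection itself still
carries `Ψ`, so the smallest closed set exists. -/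
theorem diag_compl_vectorSupport (E : ProjectionValuedMeasure H) (Ψ : H) :
    E.diag Ψ (E.vectorSupport Ψ)ᶜ = 0 := by
  refine measure_null_of_locally_null _ fun p hp => ?_
  simp only [vectorSupport, Set.mem_compl_iff, Set.mem_sInter, not_forall] at hp
  obtain ⟨S, ⟨hS, -, hSΨ⟩, hpS⟩ := hp
  exact ⟨Sᶜ, mem_nhdsWithin_of_mem_nhds (hS.isOpen_compl.mem_nhds hpS),
    (E.proj_eq_self_iff Ψ hS.measurableSet).1 hSΨ⟩

theorem support_eq_of_diag_eq {E E' : ProjectionValuedMeasure H}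
    (h : ∀ Φ, E.diag Φ = E'.diag Φ) : E.support = E'.support := by
  have key : ∀ V : Set Minkowski, IsOpen V → (E.proj V = 0 ↔ E'.proj V = 0) := fun V hV => by
    simp only [ContinuousLinearMap.ext_iff, zero_apply,
      ← diag_eq_zero_iff _ _ hV.measurableSet, h]
  ext p
  simp only [support, Set.mem_ofPred_eq]
  exact forall_congr' fun V => forall_congr' fun hV => forall_congr' fun _ => not_congr (key V hV)

theorem vectorSupport_eq_of_diag_eq {E E' : ProjectionValuedMeasure H}
    (h : ∀ Φ, E.diag Φ = E'.diag Φ) (Ψ : H) : E.vectorSupport Ψ = E'.vectorSupport Ψ := by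
  unfold vectorSupport
  congr 1
  ext S
  simp only [Set.mem_ofPred_eq, support_eq_of_diag_eq h]
  refine and_congr_right fun hS => and_congr_right fun _ => ?_
  rw [proj_eq_self_iff _ _ hS.measurableSet, proj_eq_self_iff _ _ hS.measurableSet, h]

/-- Cutting a vector carried by `S` off to larger and larger balls. -/
theorem tendsto_proj_inter_closedBall (E : ProjectionValuedMeasure H) (Φ : H) {S : Set Minkowski}
    (hS : MeasurableSet S) (hΦ : E.diag Φ Sᶜ = 0) :
    Filter.Tendsto (fun n : ℕ => E.proj (S ∩ Metric.closedBall 0 n) Φ) Filter.atTop (nhds Φ) := by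
  have hm : ∀ n : ℕ, MeasurableSet (S ∩ Metric.closedBall (0 : Minkowski) n) := fun n =>
    hS.inter Metric.isClosed_closedBall.measurableSet
  -- Continuity from above of the finite measure `E.diag Φ`: these complements decrease to `Sᶜ`.
  have h0 : Filter.Tendsto (fun n : ℕ => E.diag Φ (S ∩ Metric.closedBall 0 n)ᶜ) Filter.atTop
      (nhds 0) := by
    have := tendsto_measure_iInter_atTop (μ := E.diag Φ)
      (s := fun n : ℕ => (S ∩ Metric.closedBall (0 : Minkowski) n)ᶜ)
      (fun n => (hm n).compl.nullMeasurableSet)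
      (fun m n hmn => Set.compl_subset_compl.2 (Set.inter_subset_inter_right _
        (Metric.closedBall_subset_closedBall (by exact_mod_cast hmn))))
      ⟨0, measure_ne_top _ _⟩
    have hI : E.diag Φ (⋂ n : ℕ, (S ∩ Metric.closedBall (0 : Minkowski) n)ᶜ) = 0 := by
      rw [← Set.compl_iUnion, ← Set.inter_iUnion, Metric.iUnion_closedBall_nat, Set.inter_univ, hΦ]
    rwa [hI] at this
  have h1 : Filter.Tendsto (fun n : ℕ => ‖E.proj (S ∩ Metric.closedBall 0 n)ᶜ Φ‖ ^ 2) Filter.atTop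
      (nhds 0) := by
    have := (ENNReal.tendsto_toReal ENNReal.zero_ne_top).comp h0
    refine this.congr fun n => ?_
    simp only [Function.comp_apply]
    rw [E.diag_apply Φ (hm n).compl, ENNReal.toReal_ofReal (sq_nonneg _)]
  rw [tendsto_iff_norm_sub_tendsto_zero]
  have h2 := h1.sqrt
  simp only [Real.sqrt_zero] at h2
  refine h2.congr fun n => ?_
  rw [Real.sqrt_sq (norm_nonneg _), E.proj_compl Φ (hm n), norm_sub_rev]

theorem diag_proj_compl (E : ProjectionValuedMeasure H) (Φ : H) {S : Set Minkowski}
    (hS : MeasurableSet S) : E.diag (E.proj S Φ) Sᶜ = 0 :=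
  (E.proj_eq_self_iff _ hS).1 (E.proj_proj Φ hS)

end ProjectionValuedMeasure

/-- The spectral measure of a representation is unique. -/
theorem IsSpectralMeasure.diag_eq {E E' : ProjectionValuedMeasure H}
    {U : Multiplicative Minkowski →* unitary (H →L[ℂ] H)} (hE : IsSpectralMeasure E U)
    (hE' : IsSpectralMeasure E' U) (Φ : H) : E.diag Φ = E'.diag Φ := by
  refine Measure.ext_of_charFun (funext fun t => ?_)
  -- Inverting `rescale` writes every Euclidean character as a plane wave, so the coefficients `(Φ,
  -- U(a)Φ)` determine the characteristic function of `E.diag Φ`.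
  have key : ∀ p : Minkowski, Complex.exp (inner ℝ p t * Complex.I) =
      Complex.exp (Complex.I * (mdot p (rescale.symm ((2 * Real.pi)⁻¹ • t)) : ℂ)) := by
    intro p
    have := Real.pi_ne_zero
    rw [← inner_rescale, ContinuousLinearEquiv.apply_symm_apply, inner_smul_right, ← mul_assoc,
      mul_inv_cancel₀ (by positivity), one_mul, mul_comm]
  simp only [charFun_apply, key]
  rw [← hE, ← hE']

theorem IsSpectralMeasure.spec_eq {E : ProjectionValuedMeasure H}
    {U : Multiplicative Minkowski →* unitary (H →L[ℂ] H)} (hE : IsSpectralMeasure E U) :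
    spec U = E.support := by
  ext p
  refine ⟨fun h => h E hE, fun h E' hE' => ?_⟩
  rwa [ProjectionValuedMeasure.support_eq_of_diag_eq (hE'.diag_eq hE)]

theorem IsSpectralMeasure.vecSupp_eq {E : ProjectionValuedMeasure H}
    {U : Multiplicative Minkowski →* unitary (H →L[ℂ] H)} (hE : IsSpectralMeasure E U) (Ψ : H) :
    vecSupp U Ψ = E.vectorSupport Ψ := by
  ext p
  refine ⟨fun h => h E hE, fun h E' hE' => ?_⟩
  rwa [ProjectionValuedMeasure.vectorSupport_eq_of_diag_eq (hE'.diag_eq hE)]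

theorem isClosed_spec (U : Multiplicative Minkowski →* unitary (H →L[ℂ] H)) :
    IsClosed (spec U) := by
  simp only [spec, Set.ofPred_forall]
  exact isClosed_iInter fun E => isClosed_iInter fun _ => E.isClosed_support

end

section

/-! ### Plane waves and Fourier inversion -/

/-- The plane wave `exp (i p a)`. -/
def planeWave (p a : Minkowski) : ℂ := Complex.exp (Complex.I * (mdot p a : ℂ))

theorem mdot_add_right (p a b : Minkowski) : mdot p (a + b) = mdot p a + mdot p b := by
  simp [mdot, mul_add, Finset.sum_add_distrib]; ring

theorem mdot_neg_right (p a : Minkowski) : mdot p (-a) = -mdot p a := by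
  simp [mdot]; ring

theorem mdot_comm (p a : Minkowski) : mdot p a = mdot a p := by
  simp [mdot, mul_comm]

theorem continuous_mdot : Continuous fun x : Minkowski × Minkowski => mdot x.1 x.2 := by
  unfold mdot; fun_prop

theorem planeWave_add_right (p a b : Minkowski) :
    planeWave p (a + b) = planeWave p a * planeWave p b := by
  simp [planeWave, mdot_add_right, mul_add, Complex.exp_add]

theorem planeWave_comm (p a : Minkowski) : planeWave p a = planeWave a p := by
  simp [planeWave, mdot_comm]

theorem planeWave_add_left (p q a : Minkowski) :
    planeWave (p + q) a = planeWave p a * planeWave q a := by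
  simp only [planeWave_comm _ a, planeWave_add_right]

theorem planeWave_neg_left (p a : Minkowski) : planeWave (-p) a = planeWave p (-a) := by
  rw [planeWave_comm, planeWave, planeWave, mdot_neg_right, mdot_neg_right, mdot_comm]

theorem norm_planeWave (p a : Minkowski) : ‖planeWave p a‖ = 1 := by
  rw [planeWave, mul_comm, Complex.norm_exp_ofReal_mul_I]

theorem star_planeWave (p a : Minkowski) :
    (starRingEnd ℂ) (planeWave p a) = planeWave p (-a) := by
  simp [planeWave, ← Complex.exp_conj, mdot_neg_right]

theorem continuous_planeWave : Continuous fun x : Minkowski × Minkowski => planeWave x.1 x.2 := by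
  unfold planeWave
  have := continuous_mdot
  fun_prop

theorem fourierTest_eq_integral_planeWave (ρ : 𝓢(Minkowski, ℂ)) (a : Minkowski) :
    fourierTest ρ a = ((2 * Real.pi : ℂ) ^ 2)⁻¹ * ∫ p, planeWave p (-a) * ρ p := by
  rw [fourierTest_apply]
  simp [planeWave, mdot_neg_right]

/-- Fourier inversion, up to the normalisation. -/
theorem exists_integral_fourierTest_mul_planeWave :
    ∃ c : ℂ, c ≠ 0 ∧ ∀ (ρ : 𝓢(Minkowski, ℂ)) (p : Minkowski),
      ∫ a, fourierTest ρ a * planeWave p a = c * ρ p := by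
  -- The Jacobian of `rescale`; only its being nonzero matters.
  have hmap : ∃ d : ℝ, d ≠ 0 ∧ ∀ F : Minkowski → ℂ, ∫ a, F (rescale a) = d • ∫ a, F a := by
    have hdet : LinearMap.det (rescale : Minkowski →ₗ[ℝ] Minkowski) ≠ 0 :=
      (LinearEquiv.isUnit_det' rescale.toLinearEquiv).ne_zero
    refine ⟨|(LinearMap.det (rescale : Minkowski →ₗ[ℝ] Minkowski))⁻¹|, by simpa using hdet,
      fun F => ?_⟩
    have h := Measure.map_linearMap_addHaar_eq_smul_addHaar (volume : Measure Minkowski) hdet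
    have h2 : ∫ a, F (rescale a) =
        ∫ a, F a ∂(Measure.map (rescale : Minkowski →ₗ[ℝ] Minkowski) volume) :=
      (rescale.toHomeomorph.measurableEmbedding.integral_map F).symm
    rw [h2, h, integral_smul_measure, ENNReal.toReal_ofReal (abs_nonneg _)]
  obtain ⟨d, hd, hmap⟩ := hmap
  refine ⟨((2 * Real.pi : ℂ) ^ 2)⁻¹ * d, ?_, fun ρ p => ?_⟩
  · have := Real.pi_ne_zero
    simp [hd, this]
  let G : Minkowski → ℂ := fun v =>
    Complex.exp (((2 * Real.pi * inner ℝ v p : ℝ) : ℂ) * Complex.I) • (𝓕 ρ : 𝓢(Minkowski, ℂ)) v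
  have h1 : ∀ a, fourierTest ρ a * planeWave p a = ((2 * Real.pi : ℂ) ^ 2)⁻¹ *
      G (rescale a) := by
    intro a
    have : fourierTest ρ a = ((2 * Real.pi : ℂ) ^ 2)⁻¹ * (𝓕 ρ : 𝓢(Minkowski, ℂ)) (rescale a) := rfl
    rw [this, planeWave, ← inner_rescale, real_inner_comm, mul_comm Complex.I]
    simp only [G, smul_eq_mul]
    ring
  simp only [h1]
  rw [integral_const_mul, hmap, ← Real.fourierInv_eq', ← SchwartzMap.fourierInv_coe,
    FourierTransform.fourierInv_fourier_eq, Complex.real_smul]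
  ring

/-- A smooth cutoff of a compact set is the Fourier transform of a Schwartz function. -/
theorem exists_schwartz_cutoff {K O : Set Minkowski} (hK : IsCompact K) (hO : IsOpen O)
    (hKO : K ⊆ O) :
    ∃ f g : 𝓢(Minkowski, ℂ), ∃ k : ℂ, (∀ p ∉ O, f p = 0) ∧ (∀ p ∈ K, f p = 1) ∧
      (∀ p, ∫ c, g c * planeWave p c = f p) ∧
      (∀ c, g c = k * ∫ r, planeWave r (-c) * f r) := by
  -- A relatively compact `V` gives the bump compact support, hence makes it Schwartz.
  obtain ⟨V, hV, hKV, hVO, hVc⟩ := exists_open_between_and_isCompact_closure hK hO hKO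
  obtain ⟨f₀, hf₀, -, hsupp, hone⟩ := exists_contMDiff_support_eq_eq_one_iff
    (modelWithCornersSelf ℝ Minkowski) (n := (⊤ : ℕ∞)) hV hK.isClosed hKV
  have hcs : HasCompactSupport fun p => (f₀ p : ℂ) := by
    refine HasCompactSupport.intro' hVc isClosed_closure fun p hp => ?_
    have : p ∉ Function.support f₀ := by rw [hsupp]; exact fun h => hp (subset_closure h)
    simpa using this
  have hsm : ContDiff ℝ (⊤ : ℕ∞) fun p => (f₀ p : ℂ) :=
    Complex.ofRealCLM.contDiff.comp hf₀.contDiff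
  let f : 𝓢(Minkowski, ℂ) := hcs.toSchwartzMap hsm
  have hf : ∀ p, f p = f₀ p := fun p => rfl
  obtain ⟨c, hc, hinv⟩ := exists_integral_fourierTest_mul_planeWave
  refine ⟨f, c⁻¹ • fourierTest f, c⁻¹ * ((2 * Real.pi : ℂ) ^ 2)⁻¹, fun p hp => ?_, fun p hp => ?_,
    fun p => ?_, fun a => ?_⟩
  · have : p ∉ Function.support f₀ := by rw [hsupp]; exact fun h => hp (hVO (subset_closure h))
    rw [hf]
    simpa using this
  · rw [hf, (hone p).1 hp, Complex.ofReal_one]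
  · simp only [smul_apply, smul_eq_mul, mul_assoc]
    rw [integral_const_mul, hinv, inv_mul_cancel_left₀ hc]
  · rw [smul_apply, smul_eq_mul, fourierTest_eq_integral_planeWave, mul_assoc]

/-- If the Fourier transform of `η` vanishes where `f` does not, then so does the pairing of `η`
with the translates of the Fourier transform of `f`. -/
theorem integral_mul_translate_eq_zero {η : Minkowski → ℂ} (hη : Integrable η)
    {f g : 𝓢(Minkowski, ℂ)} {k : ℂ} (hg : ∀ c, g c = k * ∫ r, planeWave r (-c) * f r)
    (h : ∀ r, f r ≠ 0 → ∫ a, η a * planeWave r a = 0) (c : Minkowski) :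
    ∫ a, η a * g (c - a) = 0 := by
  have hint : Integrable (Function.uncurry fun a r =>
      (η a * f r) * planeWave r (a - c)) (volume.prod volume) := by
    refine (hη.mul_prod f.integrable).mul_bdd (c := 1) ?_
      (Filter.Eventually.of_forall fun z => (norm_planeWave _ _).le)
    exact (continuous_planeWave.comp (by fun_prop : Continuous fun z : Minkowski × Minkowski =>
      (z.2, z.1 - c))).aestronglyMeasurable
  have h1 : ∀ a, η a * g (c - a) = k * ∫ r, (η a * f r) * planeWave r (a - c) := by
    intro a
    rw [hg, ← mul_assoc, mul_comm (η a) k, mul_assoc, ← integral_const_mul]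
    congr 2
    ext r
    rw [neg_sub]
    ring
  simp only [h1]
  rw [integral_const_mul, integral_integral_swap hint]
  have h2 : ∀ r, ∫ a, (η a * f r) * planeWave r (a - c) = 0 := by
    intro r
    by_cases hr : f r = 0
    · simp [hr]
    · have : ∀ a, (η a * f r) * planeWave r (a - c) =
          (f r * planeWave r (-c)) * (η a * planeWave r a) := fun a => by
        rw [sub_eq_add_neg, planeWave_add_right]; ring
      simp only [this]
      rw [integral_const_mul, h r hr, mul_zero]
  simp [h2]

end

section

variable {H : Type*} [NormedAddCommGroup H] [InnerProductSpace ℂ H] [CompleteSpace H]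

/-! ### Unitary representations of the translations -/

/-- The operator `U(a)`. -/
def act (U : Multiplicative Minkowski →* unitary (H →L[ℂ] H)) (a : Minkowski) : H →L[ℂ] H :=
  (U (.ofAdd a) : H →L[ℂ] H)

variable {U : Multiplicative Minkowski →* unitary (H →L[ℂ] H)}

theorem act_add_apply (a b : Minkowski) (Φ : H) : act U (a + b) Φ = act U a (act U b Φ) := by
  simp [act, ofAdd_add]

theorem act_zero_apply (Φ : H) : act U 0 Φ = Φ := by
  simp [act]

theorem star_act (a : Minkowski) : star (act U a) = act U (-a) := by
  rw [act, act, ofAdd_neg, map_inv, ← Unitary.coe_star, Unitary.star_eq_inv]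

theorem inner_act_left (a : Minkowski) (Φ Χ : H) : ⟪act U a Φ, Χ⟫_ℂ = ⟪Φ, act U (-a) Χ⟫_ℂ := by
  rw [← star_act, ContinuousLinearMap.star_eq_adjoint, ContinuousLinearMap.adjoint_inner_right]

theorem norm_act_apply (a : Minkowski) (Φ : H) : ‖act U a Φ‖ = ‖Φ‖ := by
  have h : ⟪act U a Φ, act U a Φ⟫_ℂ = ⟪Φ, Φ⟫_ℂ := by
    rw [inner_act_left, ← act_add_apply, neg_add_cancel, act_zero_apply]
  rw [@norm_eq_sqrt_re_inner ℂ, h, ← @norm_eq_sqrt_re_inner ℂ]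

/-- Strong continuity becomes joint continuity because every `U(a)` is an isometry. -/
theorem continuous_act_apply (hU : ∀ Φ : H, Continuous fun a => act U a Φ) {v : Minkowski → H}
    (hv : Continuous v) {s : Minkowski → Minkowski} (hs : Continuous s) :
    Continuous fun a => act U (s a) (v a) := by
  rw [continuous_iff_continuousAt]
  intro a₀
  rw [ContinuousAt, tendsto_iff_norm_sub_tendsto_zero]
  have h1 : Filter.Tendsto (fun a => ‖v a - v a₀‖ + ‖act U (s a) (v a₀) - act U (s a₀) (v a₀)‖)
      (nhds a₀) (nhds 0) := by
    have hc : Continuous fun a =>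
        ‖v a - v a₀‖ + ‖act U (s a) (v a₀) - act U (s a₀) (v a₀)‖ := by
      have := (hU (v a₀)).comp hs
      simp only [Function.comp_def] at this
      fun_prop
    simpa using hc.tendsto a₀
  refine squeeze_zero (fun _ => norm_nonneg _) (fun a => ?_) h1
  have : act U (s a) (v a) - act U (s a₀) (v a₀) =
      act U (s a) (v a - v a₀) + (act U (s a) (v a₀) - act U (s a₀) (v a₀)) := by
    rw [map_sub]; abel
  rw [this]
  refine (norm_add_le _ _).trans ?_
  rw [norm_act_apply]

/-! ### Smeared representations -/

variable {E : ProjectionValuedMeasure H}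

theorem integral_mul_inner_act (hE : IsSpectralMeasure E U) {g : Minkowski → ℂ}
    (hg : Integrable g) (Φ : H) :
    ∫ c, g c * ⟪Φ, act U c Φ⟫_ℂ = ∫ p, (∫ c, g c * planeWave p c) ∂(E.diag Φ) := by
  have hint : Integrable (Function.uncurry fun c p => g c * planeWave p c)
      (volume.prod (E.diag Φ)) := by
    refine (hg.comp_fst (E.diag Φ)).mul_bdd (c := 1) ?_
      (Filter.Eventually.of_forall fun z => (norm_planeWave _ _).le)
    exact (continuous_planeWave.comp continuous_swap).aestronglyMeasurable
  rw [← integral_integral_swap hint]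
  congr 1
  ext c
  rw [integral_const_mul]
  exact congrArg _ (hE c Φ)

/-- `∫ g(c) U(c) Φ dc = k Φ` if the Fourier transform of `g` equals `k` on the spectral support
of `Φ`. -/
theorem integral_smul_act_eq (hE : IsSpectralMeasure E U)
    (hU : ∀ Φ : H, Continuous fun a => act U a Φ) {g : Minkowski → ℂ} (hg : Integrable g)
    {Φ : H} {k : ℂ} (h : ∀ᵐ p ∂(E.diag Φ), ∫ c, g c * planeWave p c = k) :
    ∫ c, g c • act U c Φ = k • Φ := by
  have hint : Integrable fun c => g c • act U c Φ :=
    hg.smul_bdd ‖Φ‖ (hU Φ).aestronglyMeasurable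
      (Filter.Eventually.of_forall fun c => (norm_act_apply c Φ).le)
  -- `IsSpectralMeasure` only knows diagonal coefficients, so testing is restricted to the orbit of
  -- `Φ`. There, `(U(b)Φ, U(c)Φ) = (Φ, U(c - b)Φ)`.
  have key : ∀ b, ⟪act U b Φ, (∫ c, g c • act U c Φ) - k • Φ⟫_ℂ = 0 := by
    intro b
    rw [inner_sub_right, ← integral_inner hint, inner_smul_right, sub_eq_zero]
    simp only [inner_smul_right]
    have h1 : ∀ c, g c * ⟪act U b Φ, act U c Φ⟫_ℂ = g (c - b + b) * ⟪Φ, act U (c - b) Φ⟫_ℂ := by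
      intro c
      rw [inner_act_left, ← act_add_apply, sub_add_cancel, neg_add_eq_sub]
    simp only [h1]
    rw [integral_sub_right_eq_self (fun c => g (c + b) * ⟪Φ, act U c Φ⟫_ℂ) b,
      integral_mul_inner_act hE (hg.comp_add_right b)]
    have h2 : ∀ᵐ p ∂(E.diag Φ), ∫ c, g (c + b) * planeWave p c = k * planeWave p (-b) := by
      filter_upwards [h] with p hp
      have h3 : ∀ c, g (c + b) * planeWave p c =
          (fun c => planeWave p (-b) * (g c * planeWave p c)) (c + b) := by
        intro c
        simp only [planeWave_add_right]
        have : planeWave p (-b) * planeWave p b = 1 := by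
          rw [← planeWave_add_right, neg_add_cancel]
          simp [planeWave, mdot]
        linear_combination (-(g (c + b) * planeWave p c)) * this
      simp only [h3]
      rw [integral_add_right_eq_self (fun c => planeWave p (-b) * (g c * planeWave p c)),
        integral_const_mul, hp, mul_comm]
    rw [integral_congr_ae h2, integral_const_mul, inner_act_left]
    exact congrArg _ (hE (-b) Φ).symm
  -- The difference is built from orbit vectors, to all of which it is orthogonal; hence it is
  -- orthogonal to itself.
  rw [← sub_eq_zero, ← @inner_self_eq_zero ℂ]
  set v := (∫ c, g c • act U c Φ) - k • Φ with hv
  have key' : ∀ b, ⟪v, act U b Φ⟫_ℂ = 0 := fun b => by rw [← inner_conj_symm, key b, map_zero]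
  have key0 : ⟪v, Φ⟫_ℂ = 0 := by simpa [act_zero_apply] using key' 0
  change ⟪v, (∫ c, g c • act U c Φ) - k • Φ⟫_ℂ = 0
  rw [inner_sub_right, ← integral_inner hint, inner_smul_right, key0]
  simp [inner_smul_right, key']

/-- Writing `U(a)Φ = ∫ g(c - a) U(c)Φ dc` and applying Fubini leaves, for each `c`, the convolution
of `a ↦ ω(a)(N(a), U(c)Φ)` with `g`. Its transform is a product with `f`, which vanishes off `O`,
while `h` kills the other factor on `O`. -/
theorem integral_mul_inner_act_eq_zero (hE : IsSpectralMeasure E U)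
    (hU : ∀ Φ : H, Continuous fun a => act U a Φ) {ω : Minkowski → ℂ} (hω : Integrable ω)
    {N : Minkowski → H} (hN : Continuous N) {C : ℝ} (hNC : ∀ a, ‖N a‖ ≤ C) {Φ : H}
    {K O : Set Minkowski} (hK : IsCompact K) (hO : IsOpen O) (hKO : K ⊆ O)
    (hΦ : E.diag Φ Kᶜ = 0)
    (h : ∀ r ∈ O, ∀ Χ, ∫ a, ω a * ⟪N a, Χ⟫_ℂ * planeWave r a = 0) :
    ∫ a, ω a * ⟪N a, act U a Φ⟫_ℂ = 0 := by
  obtain ⟨f, g, k, hf0, hf1, hgf, hg⟩ := exists_schwartz_cutoff hK hO hKO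
  have hrep : ∫ c, g c • act U c Φ = Φ := by
    have := integral_smul_act_eq hE hU g.integrable (Φ := Φ) (k := 1) (by
      have hae : ∀ᵐ p ∂(E.diag Φ), p ∈ K := hΦ
      filter_upwards [hae] with p hp
      rw [hgf, hf1 p hp])
    rwa [one_smul] at this
  have hrep' : ∀ a, ⟪N a, act U a Φ⟫_ℂ = ∫ c, g (c - a) * ⟪N a, act U c Φ⟫_ℂ := by
    intro a
    have hint : Integrable fun c => g c • act U c Φ :=
      g.integrable.smul_bdd ‖Φ‖ (hU Φ).aestronglyMeasurable
        (Filter.Eventually.of_forall fun c => (norm_act_apply c Φ).le)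
    have h1 : ∀ c, g (c - a) * ⟪N a, act U c Φ⟫_ℂ =
        (fun c => ⟪act U (-a) (N a), g c • act U c Φ⟫_ℂ) (c - a) := by
      intro c
      simp only [inner_smul_right]
      rw [inner_act_left, ← act_add_apply, neg_neg, add_sub_cancel]
    simp only [h1]
    rw [integral_sub_right_eq_self (fun c => ⟪act U (-a) (N a), g c • act U c Φ⟫_ℂ),
      integral_inner hint, hrep, inner_act_left, neg_neg]
  have hint : Integrable (Function.uncurry fun a c =>
      (ω a * g (c - a)) * ⟪N a, act U c Φ⟫_ℂ) (volume.prod volume) := by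
    have h1 : Integrable (fun z : Minkowski × Minkowski => ω z.1 * g (z.2 - z.1))
        (volume.prod volume) := by
      have := hω.convolution_integrand (ContinuousLinearMap.mul ℂ ℂ) g.integrable
        (μ := volume) (ν := volume)
      simpa [Function.comp_def] using this.swap
    refine h1.mul_bdd (c := C * ‖Φ‖) ?_ (Filter.Eventually.of_forall fun z => ?_)
    · have h2 : Continuous fun z : Minkowski × Minkowski => ⟪N z.1, act U z.2 Φ⟫_ℂ :=
        (hN.comp continuous_fst).inner ((hU Φ).comp continuous_snd)
      exact h2.aestronglyMeasurable
    · refine (norm_inner_le_norm _ _).trans ?_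
      rw [norm_act_apply]
      exact mul_le_mul_of_nonneg_right (hNC _) (norm_nonneg _)
  have h2 : ∀ a, ω a * ⟪N a, act U a Φ⟫_ℂ =
      ∫ c, (ω a * g (c - a)) * ⟪N a, act U c Φ⟫_ℂ := by
    intro a
    rw [hrep', ← integral_const_mul]
    simp only [mul_assoc]
  simp only [h2]
  rw [integral_integral_swap hint]
  have h3 : ∀ c, ∫ a, (ω a * g (c - a)) * ⟪N a, act U c Φ⟫_ℂ = 0 := by
    intro c
    have hη : Integrable fun a => ω a * ⟪N a, act U c Φ⟫_ℂ := by
      refine hω.mul_bdd (c := C * ‖Φ‖) (hN.inner continuous_const).aestronglyMeasurable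
        (Filter.Eventually.of_forall fun a => ?_)
      refine (norm_inner_le_norm _ _).trans ?_
      rw [norm_act_apply]
      exact mul_le_mul_of_nonneg_right (hNC _) (norm_nonneg _)
    have := integral_mul_translate_eq_zero hη hg (fun r hr => h r (by
      by_contra hr'
      exact hr (hf0 r hr')) (act U c Φ)) c
    rw [← this]
    congr 1
    ext a
    ring
  simp [h3]

theorem integral_mul_inner_act_neg_eq_zero (hE : IsSpectralMeasure E U)
    (hU : ∀ Φ : H, Continuous fun a => act U a Φ) {ω : Minkowski → ℂ} (hω : Integrable ω)
    {N : Minkowski → H} (hN : Continuous N) {C : ℝ} (hNC : ∀ a, ‖N a‖ ≤ C) {Φ : H}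
    {K O : Set Minkowski} (hK : IsCompact K) (hO : IsOpen O) (hKO : K ⊆ O)
    (hΦ : E.diag Φ Kᶜ = 0)
    (h : ∀ r ∈ O, ∀ Χ, ∫ a, ω a * ⟪N a, Χ⟫_ℂ * planeWave r (-a) = 0) :
    ∫ a, ω a * ⟪N a, act U (-a) Φ⟫_ℂ = 0 := by
  rw [← integral_neg_eq_self]
  simp only [neg_neg]
  refine integral_mul_inner_act_eq_zero hE hU hω.comp_neg (hN.comp continuous_neg)
    (fun a => hNC (-a)) hK hO hKO hΦ fun r hr Χ => ?_
  rw [← h r hr Χ, ← integral_neg_eq_self]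
  simp

/-- Complex conjugation moves the unitary to the right slot and turns `exp(ira)` into `exp(-ira)`.
-/
theorem integral_mul_inner_act_neg_left_eq_zero (hE : IsSpectralMeasure E U)
    (hU : ∀ Φ : H, Continuous fun a => act U a Φ) {ω : Minkowski → ℂ} (hω : Integrable ω)
    {Φ : H} {K O : Set Minkowski} (hK : IsCompact K) (hO : IsOpen O) (hKO : K ⊆ O)
    (hΦ : E.diag Φ Kᶜ = 0) (h : ∀ r ∈ O, ∫ a, ω a * planeWave r a = 0) (Χ : H) :
    ∫ a, ω a * ⟪act U (-a) Φ, Χ⟫_ℂ = 0 := by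
  have hω' : Integrable fun a => (starRingEnd ℂ) (ω a) :=
    Complex.conjCLE.toContinuousLinearMap.integrable_comp hω
  have := integral_mul_inner_act_neg_eq_zero hE hU hω' (N := fun _ => Χ) continuous_const
    (fun _ => le_rfl) hK hO hKO hΦ fun r hr Χ' => by
      have h1 : ∀ a, (starRingEnd ℂ) (ω a) * ⟪Χ, Χ'⟫_ℂ * planeWave r (-a) =
          ⟪Χ, Χ'⟫_ℂ * (starRingEnd ℂ) (ω a * planeWave r a) := fun a => by
        rw [map_mul, star_planeWave]; ring
      simp only [h1]
      rw [integral_const_mul, integral_conj, h r hr, map_zero, mul_zero]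
  have h2 : ∀ a, ω a * ⟪act U (-a) Φ, Χ⟫_ℂ =
      (starRingEnd ℂ) ((starRingEnd ℂ) (ω a) * ⟪Χ, act U (-a) Φ⟫_ℂ) := fun a => by
    rw [map_mul, Complex.conj_conj, inner_conj_symm]
  simp only [h2]
  rw [integral_conj, this, map_zero]

theorem integrable_mul_planeWave {ω : Minkowski → ℂ} (hω : Integrable ω) (r : Minkowski)
    {s : Minkowski → Minkowski} (hs : Continuous s) :
    Integrable fun a => ω a * planeWave r (s a) :=
  hω.mul_bdd (c := 1)
    (continuous_planeWave.comp (continuous_const.prodMk hs)).aestronglyMeasurable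
    (Filter.Eventually.of_forall fun _ => (norm_planeWave _ _).le)

/-- The momentum space support of `a ↦ (Φ₁, U(a) X U(-a) Z U(a) Φ₂)`. -/
theorem integral_mul_inner_act_act_act_eq_zero (hE : IsSpectralMeasure E U)
    (hU : ∀ Φ : H, Continuous fun a => act U a Φ) {ω : Minkowski → ℂ} (hω : Integrable ω)
    (X Z : H →L[ℂ] H) {Φ₁ Φ₂ : H} {K₁ K₂ K O₁ O₂ O : Set Minkowski}
    (hK₁ : IsCompact K₁) (hO₁ : IsOpen O₁) (hKO₁ : K₁ ⊆ O₁) (hΦ₁ : E.diag Φ₁ K₁ᶜ = 0)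
    (hK₂ : IsCompact K₂) (hO₂ : IsOpen O₂) (hKO₂ : K₂ ⊆ O₂) (hΦ₂ : E.diag Φ₂ K₂ᶜ = 0)
    (hK : IsCompact K) (hO : IsOpen O) (hKO : K ⊆ O) (hZ : ∀ Φ, E.diag (Z Φ) Kᶜ = 0)
    (h : ∀ p ∈ O₁, ∀ r ∈ O₂, ∀ q ∈ O, ∫ a, ω a * planeWave (p + r - q) a = 0) :
    ∫ a, ω a * ⟪Φ₁, act U a (X (act U (-a) (Z (act U a Φ₂))))⟫_ℂ = 0 := by
  -- Passing to adjoints gathers everything left of one unitary into a bounded continuous vector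
  -- function. The unitaries are then removed from right to left, with momenta `r`, `q`, `p`.
  let X' := ContinuousLinearMap.adjoint X
  let Z' := ContinuousLinearMap.adjoint Z
  let N₁ : Minkowski → H := fun a => X' (act U (-a) Φ₁)
  have hN₁ : Continuous N₁ := X'.continuous.comp ((hU Φ₁).comp continuous_neg)
  have hN₁C : ∀ a, ‖N₁ a‖ ≤ ‖X'‖ * ‖Φ₁‖ := fun a => by
    rw [← norm_act_apply (U := U) (-a) Φ₁]
    exact X'.le_opNorm _
  let N₂ : Minkowski → H := fun a => Z' (act U a (N₁ a))
  have hN₂ : Continuous N₂ := Z'.continuous.comp (continuous_act_apply hU hN₁ continuous_id)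
  have hN₂C : ∀ a, ‖N₂ a‖ ≤ ‖Z'‖ * (‖X'‖ * ‖Φ₁‖) := fun a => by
    refine (Z'.le_opNorm _).trans ?_
    rw [norm_act_apply]
    exact mul_le_mul_of_nonneg_left (hN₁C a) (norm_nonneg _)
  have e : ∀ a, ⟪Φ₁, act U a (X (act U (-a) (Z (act U a Φ₂))))⟫_ℂ = ⟪N₂ a, act U a Φ₂⟫_ℂ := by
    intro a
    simp only [N₂, N₁, X', Z', ContinuousLinearMap.adjoint_inner_left, inner_act_left, neg_neg]
  simp only [e]
  refine integral_mul_inner_act_eq_zero hE hU hω hN₂ hN₂C hK₂ hO₂ hKO₂ hΦ₂ fun r hr Χ => ?_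
  have e₁ : ∀ a, ω a * ⟪N₂ a, Χ⟫_ℂ * planeWave r a =
      (ω a * planeWave r a) * ⟪N₁ a, act U (-a) (Z Χ)⟫_ℂ := by
    intro a
    simp only [N₂, Z', ContinuousLinearMap.adjoint_inner_left, inner_act_left]
    ring
  simp only [e₁]
  have hωr := integrable_mul_planeWave hω r (s := fun a => a) continuous_id
  refine integral_mul_inner_act_neg_eq_zero hE hU hωr hN₁ hN₁C hK hO hKO (hZ Χ)
    fun q hq Χ' => ?_
  have e₂ : ∀ a, (ω a * planeWave r a) * ⟪N₁ a, Χ'⟫_ℂ * planeWave q (-a) =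
      ((ω a * planeWave r a) * planeWave q (-a)) * ⟪act U (-a) Φ₁, X Χ'⟫_ℂ := by
    intro a
    simp only [N₁, X', ContinuousLinearMap.adjoint_inner_left]
    ring
  simp only [e₂]
  refine integral_mul_inner_act_neg_left_eq_zero hE hU
    (integrable_mul_planeWave hωr q (s := fun a => -a) continuous_neg) hK₁ hO₁ hKO₁ hΦ₁ (fun p hp => ?_) _
  rw [← h p hp r hr q hq]
  congr 1
  ext a
  rw [sub_eq_add_neg, planeWave_add_left, planeWave_add_left, planeWave_neg_left]
  ring

end

section

/-! ### Tempered distributions given by bounded continuous functions -/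

theorem exists_isGivenBy {F : Minkowski → ℂ} (hF : Continuous F) {C : ℝ} (hC : ∀ a, ‖F a‖ ≤ C) :
    ∃ T : 𝓢'(Minkowski, ℂ), IsGivenBy T F := by
  have hmem : MemLp F ⊤ (volume : Measure Minkowski) :=
    memLp_top_of_bound hF.aestronglyMeasurable C (Filter.Eventually.of_forall hC)
  refine ⟨Lp.toTemperedDistribution hmem.toLp, fun ρ => ⟨?_, ?_⟩⟩
  · exact ρ.integrable.bdd_mul hF.aestronglyMeasurable (Filter.Eventually.of_forall hC)
  · rw [Lp.toTemperedDistribution_apply]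
    refine integral_congr_ae ?_
    filter_upwards [hmem.coeFn_toLp] with a ha
    rw [ha, smul_eq_mul, mul_comm]

theorem IsGivenBy.fourierDist_apply {T : 𝓢'(Minkowski, ℂ)} {F : Minkowski → ℂ}
    (h : IsGivenBy T F) (ρ : 𝓢(Minkowski, ℂ)) :
    fourierDist T ρ = ∫ a, fourierTest ρ a * F a := by
  have : fourierDist T ρ = T (fourierTest ρ) := rfl
  rw [this, (h _).2]
  simp only [mul_comm]

theorem dsupport_subset_of_isVanishingOn {T : 𝓢'(Minkowski, ℂ)} {S : Set Minkowski}
    (h : IsVanishingOn T Sᶜ) : dsupport T ⊆ closure S := fun p hp =>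
  (mem_dsupport_iff p).1 hp _ (h.mono (Set.compl_subset_compl.2 subset_closure)) isClosed_closure

/-! ### Momentum supports of the correlation functions -/

variable {H : Type*} [NormedAddCommGroup H] [InnerProductSpace ℂ H] [CompleteSpace H]
  {U : Multiplicative Minkowski →* unitary (H →L[ℂ] H)} {E : ProjectionValuedMeasure H}

theorem isVanishingOn_fourierDist_inner_act (hE : IsSpectralMeasure E U) {T : 𝓢'(Minkowski, ℂ)}
    {Φ : H} (hT : IsGivenBy T fun a => ⟪Φ, act U a Φ⟫_ℂ) {V : Set Minkowski} (hV : IsOpen V)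
    (h0 : E.proj V = 0) : IsVanishingOn (fourierDist T) V := by
  intro ρ hρ
  obtain ⟨c, -, hinv⟩ := exists_integral_fourierTest_mul_planeWave
  rw [hT.fourierDist_apply, integral_mul_inner_act hE (fourierTest ρ).integrable]
  simp only [hinv]
  refine integral_eq_zero_of_ae ?_
  have hd : E.diag Φ V = 0 := by
    rw [E.diag_eq_zero_iff Φ hV.measurableSet, h0, zero_apply]
  filter_upwards [measure_eq_zero_iff_ae_notMem.1 hd] with p hp
  rw [image_eq_zero_of_notMem_tsupport fun h => hp (hρ h), mul_zero, Pi.zero_apply]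

/-- The tube lemma applied twice. It gives the cutoffs room around the compact supports. -/
theorem exists_isOpen_forall_add_sub_mem {K₁ K₂ K W : Set Minkowski} (hK₁ : IsCompact K₁)
    (hK₂ : IsCompact K₂) (hK : IsCompact K) (hW : IsOpen W)
    (h : ∀ p ∈ K₁, ∀ r ∈ K₂, ∀ q ∈ K, p + r - q ∈ W) :
    ∃ O₁ O₂ O : Set Minkowski, IsOpen O₁ ∧ IsOpen O₂ ∧ IsOpen O ∧ K₁ ⊆ O₁ ∧ K₂ ⊆ O₂ ∧ K ⊆ O ∧
      ∀ p ∈ O₁, ∀ r ∈ O₂, ∀ q ∈ O, p + r - q ∈ W := by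
  have hopen : IsOpen {z : (Minkowski × Minkowski) × Minkowski | z.1.1 + z.1.2 - z.2 ∈ W} :=
    hW.preimage (by fun_prop)
  obtain ⟨u, O, hu, hO, hKu, hKO, huO⟩ := generalized_tube_lemma (hK₁.prod hK₂) hK hopen
    (fun z hz => h _ hz.1.1 _ hz.1.2 _ hz.2)
  obtain ⟨O₁, O₂, hO₁, hO₂, hKO₁, hKO₂, hOu⟩ := generalized_tube_lemma hK₁ hK₂ hu hKu
  exact ⟨O₁, O₂, O, hO₁, hO₂, hO, hKO₁, hKO₂, hKO, fun p hp r hr q hq =>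
    huO (Set.mk_mem_prod (hOu (Set.mk_mem_prod hp hr)) hq)⟩

theorem tendsto_clm_apply_of_norm_le {V : Type*} [NormedAddCommGroup V] [NormedSpace ℂ V]
    {B : ℕ → V →L[ℂ] V} (hB : ∀ n Φ, ‖B n Φ‖ ≤ ‖Φ‖) {v : ℕ → V}
    {Φ Φ' : V} (hv : Filter.Tendsto v Filter.atTop (nhds Φ))
    (hΦ : Filter.Tendsto (fun n => B n Φ) Filter.atTop (nhds Φ')) :
    Filter.Tendsto (fun n => B n (v n)) Filter.atTop (nhds Φ') := by
  have h1 : Filter.Tendsto (fun n => B n (v n - Φ)) Filter.atTop (nhds 0) := by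
    refine squeeze_zero_norm (fun n => hB n _) ?_
    simpa using (hv.sub_const Φ).norm
  simpa using h1.add hΦ

/-- Exhaustion by compact supports: `Ψ` is replaced by `E(K n)Ψ` on both sides and `Y` by `E(L n)Y`.
-/
theorem integral_mul_inner_act_act_act_eq_zero_of_support (hE : IsSpectralMeasure E U)
    (hU : ∀ Φ : H, Continuous fun a => act U a Φ) (X Y : H →L[ℂ] H) (Ψ : H)
    (ρ : 𝓢(Minkowski, ℂ))
    (hρ : tsupport ρ ⊆ (E.vectorSupport Ψ + E.vectorSupport Ψ - E.support)ᶜ) :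
    ∫ a, fourierTest ρ a * ⟪Ψ, act U a (X (act U (-a) (Y (act U a Ψ))))⟫_ℂ = 0 := by
  obtain ⟨c, -, hinv⟩ := exists_integral_fourierTest_mul_planeWave
  let K : ℕ → Set Minkowski := fun n => E.vectorSupport Ψ ∩ Metric.closedBall 0 n
  let L : ℕ → Set Minkowski := fun n => E.support ∩ Metric.closedBall 0 n
  have hK : ∀ n, IsCompact (K n) := fun n =>
    (isCompact_closedBall _ _).inter_left (E.isClosed_vectorSupport Ψ)
  have hL : ∀ n, IsCompact (L n) := fun n => (isCompact_closedBall _ _).inter_left E.isClosed_support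
  let Ψ' : ℕ → H := fun n => E.proj (K n) Ψ
  let P : ℕ → H →L[ℂ] H := fun n => E.proj (L n)
  have hΨ' : Filter.Tendsto Ψ' Filter.atTop (nhds Ψ) :=
    E.tendsto_proj_inter_closedBall Ψ (E.isClosed_vectorSupport Ψ).measurableSet
      (E.diag_compl_vectorSupport Ψ)
  have hP : ∀ Φ, Filter.Tendsto (fun n => P n Φ) Filter.atTop (nhds Φ) := fun Φ =>
    E.tendsto_proj_inter_closedBall Φ E.isClosed_support.measurableSet (E.diag_compl_support Φ)
  have hPle : ∀ n Φ, ‖P n Φ‖ ≤ ‖Φ‖ := fun n Φ => E.norm_proj_apply_le Φ (hL n).measurableSet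
  have hΨ'le : ∀ n, ‖Ψ' n‖ ≤ ‖Ψ‖ := fun n => E.norm_proj_apply_le Ψ (hK n).measurableSet
  let G : ℕ → Minkowski → ℂ := fun n a =>
    ⟪Ψ' n, act U a (X (act U (-a) ((P n ∘L Y) (act U a (Ψ' n)))))⟫_ℂ
  have hG0 : ∀ n, ∫ a, fourierTest ρ a * G n a = 0 := by
    intro n
    obtain ⟨O₁, O₂, O, hO₁, hO₂, hO, hKO₁, hKO₂, hKO, hW⟩ :=
      exists_isOpen_forall_add_sub_mem (hK n) (hK n) (hL n)
        (isClosed_tsupport (ρ : Minkowski → ℂ)).isOpen_compl fun p hp r hr q hq hmem =>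
          hρ hmem (Set.sub_mem_sub (Set.add_mem_add hp.1 hr.1) hq.1)
    refine integral_mul_inner_act_act_act_eq_zero hE hU (fourierTest ρ).integrable X (P n ∘L Y)
      (hK n) hO₁ hKO₁ (E.diag_proj_compl Ψ (hK n).measurableSet)
      (hK n) hO₂ hKO₂ (E.diag_proj_compl Ψ (hK n).measurableSet)
      (hL n) hO hKO (fun Φ => E.diag_proj_compl (Y Φ) (hL n).measurableSet)
      fun p hp r hr q hq => ?_
    rw [hinv, image_eq_zero_of_notMem_tsupport (hW p hp r hr q hq), mul_zero]
  have hGc : ∀ n, Continuous (G n) := by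
    intro n
    refine continuous_const.inner (continuous_act_apply hU (X.continuous.comp
      (continuous_act_apply hU ((P n ∘L Y).continuous.comp (hU _)) continuous_neg)) continuous_id)
  have hGle : ∀ n a, ‖G n a‖ ≤ ‖Ψ‖ * (‖X‖ * (‖Y‖ * ‖Ψ‖)) := by
    intro n a
    refine (norm_inner_le_norm _ _).trans (mul_le_mul (hΨ'le n) ?_ (norm_nonneg _) (norm_nonneg _))
    rw [norm_act_apply]
    refine (X.le_opNorm _).trans (mul_le_mul_of_nonneg_left ?_ (norm_nonneg _))
    rw [norm_act_apply]
    refine (hPle n _).trans ((Y.le_opNorm _).trans (mul_le_mul_of_nonneg_left ?_ (norm_nonneg _)))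
    rw [norm_act_apply]
    exact hΨ'le n
  have hGt : ∀ a, Filter.Tendsto (fun n => G n a) Filter.atTop
      (nhds ⟪Ψ, act U a (X (act U (-a) (Y (act U a Ψ))))⟫_ℂ) := by
    intro a
    have h1 : Filter.Tendsto (fun n => Y (act U a (Ψ' n))) Filter.atTop
        (nhds (Y (act U a Ψ))) :=
      ((Y ∘L act U a).continuous.tendsto Ψ).comp hΨ'
    have h2 := tendsto_clm_apply_of_norm_le hPle h1 (hP _)
    exact hΨ'.inner (((act U a ∘L X ∘L act U (-a)).continuous.tendsto _).comp h2)
  -- The bound is uniform in `n` because projections are contractions and the `U(a)` are isometric;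
  -- the Schwartz factor makes it integrable.
  have hlim := tendsto_integral_of_dominated_convergence
    (F := fun n a => fourierTest ρ a * G n a)
    (f := fun a => fourierTest ρ a * ⟪Ψ, act U a (X (act U (-a) (Y (act U a Ψ))))⟫_ℂ)
    (fun a => ‖fourierTest ρ a‖ * (‖Ψ‖ * (‖X‖ * (‖Y‖ * ‖Ψ‖))))
    (fun n => ((fourierTest ρ).continuous.mul (hGc n)).aestronglyMeasurable)
    (((fourierTest ρ).integrable (μ := volume)).norm.mul_const _)
    (fun n => Filter.Eventually.of_forall fun a => by
      rw [norm_mul]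
      exact mul_le_mul_of_nonneg_left (hGle n a) (norm_nonneg _))
    (Filter.Eventually.of_forall fun a => (hGt a).const_mul _)
  simp only [hG0] at hlim
  exact tendsto_nhds_unique hlim tendsto_const_nhds

theorem isVanishingOn_fourierDist_inner_act_act_act
    (hU : ∀ Φ : H, Continuous fun a => act U a Φ) (X Y : H →L[ℂ] H) (Ψ : H)
    {T : 𝓢'(Minkowski, ℂ)}
    (hT : IsGivenBy T fun a => ⟪Ψ, act U a (X (act U (-a) (Y (act U a Ψ))))⟫_ℂ) :
    IsVanishingOn (fourierDist T) (vecSupp U Ψ + vecSupp U Ψ - spec U)ᶜ := by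
  intro ρ hρ
  by_cases hex : ∃ E : ProjectionValuedMeasure H, IsSpectralMeasure E U
  · obtain ⟨E, hE⟩ := hex
    rw [hE.spec_eq, hE.vecSupp_eq] at hρ
    rw [hT.fourierDist_apply]
    exact integral_mul_inner_act_act_act_eq_zero_of_support hE hU X Y Ψ ρ hρ
  -- Without a spectral measure both sets are everything by definition, so `ρ` has empty support.
  -- Existence of `E` is therefore never needed.
  · have h1 : spec U = Set.univ :=
      Set.eq_univ_of_forall fun p E hE => absurd ⟨E, hE⟩ hex
    have h2 : vecSupp U Ψ = Set.univ :=
      Set.eq_univ_of_forall fun p E hE => absurd ⟨E, hE⟩ hex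
    have hρ0 : ρ = 0 := by
      ext p
      refine image_eq_zero_of_notMem_tsupport fun hp => hρ hp ?_
      rw [h1, h2]
      exact ⟨p, ⟨p, trivial, 0, trivial, add_zero p⟩, 0, trivial, sub_zero p⟩
    rw [hρ0, map_zero]

namespace CovariantRepresentation

variable {A : Type*} [NonUnitalCStarAlgebra A] {α : Multiplicative Minkowski →* (A ≃⋆ₐ[ℂ] A)}

theorem Fplus_eq (R : CovariantRepresentation α H) (x : A) (Ψ : H) :
    R.Fplus x Ψ = fun a => ⟪R.π x Ψ, act R.U a (R.π x Ψ)⟫_ℂ := by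
  ext a
  rw [Fplus, map_star, ContinuousLinearMap.star_eq_adjoint,
    ContinuousLinearMap.adjoint_inner_right, act]

/-- Covariance turns `α_a` into conjugation by `U(a)`, which exposes the three unitaries. -/
theorem Fminus_eq (R : CovariantRepresentation α H) (x : A) (Ψ : H) :
    R.Fminus x Ψ = fun a =>
      ⟪Ψ, act R.U a (R.π x (act R.U (-a) (R.π (star x) (act R.U a Ψ))))⟫_ℂ := by
  ext a
  rw [Fminus, ← R.covariant, ← star_act]
  rfl

end CovariantRepresentation

end

end LocalQFT

end

theorem mainTheorem10 {A : Type*} [NonUnitalCStarAlgebra A]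
    (α : Multiplicative LocalQFT.Minkowski →* (A ≃⋆ₐ[ℂ] A))
    {H : Type*} [NormedAddCommGroup H] [InnerProductSpace ℂ H] [CompleteSpace H]
    (R : LocalQFT.CovariantRepresentation α H) (x : A) (Ψ : H) :
    (Continuous (R.Fplus x Ψ) ∧ (∃ C : ℝ, ∀ a, ‖R.Fplus x Ψ a‖ ≤ C) ∧
      ∃ T : 𝓢'(LocalQFT.Minkowski, ℂ), LocalQFT.IsGivenBy T (R.Fplus x Ψ) ∧
        dsupport (LocalQFT.fourierDist T) ⊆ LocalQFT.spec R.U) ∧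
    (Continuous (R.Fminus x Ψ) ∧ (∃ C : ℝ, ∀ a, ‖R.Fminus x Ψ a‖ ≤ C) ∧
      ∃ T : 𝓢'(LocalQFT.Minkowski, ℂ), LocalQFT.IsGivenBy T (R.Fminus x Ψ) ∧
        IsVanishingOn (LocalQFT.fourierDist T)
          (LocalQFT.vecSupp R.U Ψ + LocalQFT.vecSupp R.U Ψ - LocalQFT.spec R.U)ᶜ ∧
        dsupport (LocalQFT.fourierDist T) ⊆
          closure (LocalQFT.vecSupp R.U Ψ + LocalQFT.vecSupp R.U Ψ - LocalQFT.spec R.U) ∧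
        (IsCompact (LocalQFT.vecSupp R.U Ψ) →
          dsupport (LocalQFT.fourierDist T) ⊆
            LocalQFT.vecSupp R.U Ψ + LocalQFT.vecSupp R.U Ψ - LocalQFT.spec R.U)) := by
  have hU : ∀ Φ : H, Continuous fun a => LocalQFT.act R.U a Φ := R.continuous
  rw [R.Fplus_eq, R.Fminus_eq]
  constructor
  · have hc : Continuous fun a => ⟪R.π x Ψ, LocalQFT.act R.U a (R.π x Ψ)⟫_ℂ :=
      continuous_const.inner (hU _)
    have hb : ∀ a, ‖⟪R.π x Ψ, LocalQFT.act R.U a (R.π x Ψ)⟫_ℂ‖ ≤ ‖R.π x Ψ‖ * ‖R.π x Ψ‖ := by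
      intro a
      simpa only [LocalQFT.norm_act_apply] using
        norm_inner_le_norm (𝕜 := ℂ) (R.π x Ψ) (LocalQFT.act R.U a (R.π x Ψ))
    obtain ⟨T, hT⟩ := LocalQFT.exists_isGivenBy hc hb
    refine ⟨hc, ⟨_, hb⟩, T, hT, fun p hp E hE V hV hpV h0 => ?_⟩
    exact (notMem_dsupport_iff p).2
      ⟨V, LocalQFT.isVanishingOn_fourierDist_inner_act hE hT hV h0, hV, hpV⟩ hp
  · have hc : Continuous fun a => ⟪Ψ, LocalQFT.act R.U a
        (R.π x (LocalQFT.act R.U (-a) (R.π (star x) (LocalQFT.act R.U a Ψ))))⟫_ℂ :=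
      continuous_const.inner (LocalQFT.continuous_act_apply hU ((R.π x).continuous.comp
        (LocalQFT.continuous_act_apply hU ((R.π (star x)).continuous.comp (hU Ψ))
          continuous_neg)) continuous_id)
    have hb : ∀ a, ‖⟪Ψ, LocalQFT.act R.U a
        (R.π x (LocalQFT.act R.U (-a) (R.π (star x) (LocalQFT.act R.U a Ψ))))⟫_ℂ‖ ≤
        ‖Ψ‖ * (‖R.π x‖ * (‖R.π (star x)‖ * ‖Ψ‖)) := by
      intro a
      refine (norm_inner_le_norm _ _).trans (mul_le_mul_of_nonneg_left ?_ (norm_nonneg _))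
      rw [LocalQFT.norm_act_apply]
      refine ((R.π x).le_opNorm _).trans (mul_le_mul_of_nonneg_left ?_ (norm_nonneg _))
      rw [LocalQFT.norm_act_apply]
      refine ((R.π (star x)).le_opNorm _).trans_eq ?_
      rw [LocalQFT.norm_act_apply]
    obtain ⟨T, hT⟩ := LocalQFT.exists_isGivenBy hc hb
    have hvan := LocalQFT.isVanishingOn_fourierDist_inner_act_act_act hU _ _ Ψ hT
    have hsub := LocalQFT.dsupport_subset_of_isVanishingOn hvan
    refine ⟨hc, ⟨_, hb⟩, T, hT, hvan, hsub, fun hcomp => ?_⟩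
    -- A compact set plus a closed set is closed.
    have hclosed : IsClosed
        (LocalQFT.vecSupp R.U Ψ + LocalQFT.vecSupp R.U Ψ - LocalQFT.spec R.U) := by
      rw [sub_eq_add_neg]
      exact (LocalQFT.isClosed_spec R.U).neg.add_left_of_isCompact (hcomp.add hcomp)
    rwa [hclosed.closure_eq] at hsub
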